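/- Let $X_1,X_2,\dots$ be i.i.d. real random variables whose distribution function satisfies $F(x)=x^{\lambda}$ for $x\in(0,1)$, for some $\lambda>0$ (the null hypothesis $H_0$: a power function distribution). Put $$F_n(t)=\frac1n\sum_{i=1}^n\mathbf 1\{X_i<t\},\qquad H_n(t)=\binom n2^{-1}\sum_{1\le i<j\le n}\mathbf 1\Big\{\min\Big(\frac{X_i}{X_j},\frac{X_j}{X_i}\Big)<t\Big\},\qquad I_n^{PR}=\int_0^1\big(H_n(t)-F_n(t)\big)\,dF_n(t),$$ and $$\Psi_{PR}(x,y,z)=\frac13\Big(\mathbf 1\{\min(\tfrac xy,\tfrac yx)<z\}+\mathbf 1\{\min(\tfrac xz,\tfrac zx)<y\}+\mathbf 1\{\min(\tfrac yz,\tfrac zy)<x\}\Big)-\frac12 .$$ Then $E\,\Psi_{PR}(X_1,X_2,X_3)=0$, and the projection of $\Psi_{PR}$ is $$\psi_{PR}(s):=E\,\Psi_{PR}(s,X_2,X_3)=\frac16+\frac23\,s^{\lambda}\ln(s^{\lambda}),\qquad 0\le s\le1$$ (with $0\ln0=0$ and the term $\min(\tfrac sy,\tfrac ys)$ read as $0$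 at $s=0$), which is also a version of $E(\Psi_{PR}(X_1,X_2,X_3)\mid X_1=s)$. In particular $\psi_{PR}(s)=\frac16+\frac23 s\ln s$ when $\lambda=1$, that is, for a uniform sample on $(0,1)$. For every $\lambda>0$ the variance of $\psi_{PR}(X_1)$ equals $\frac{5}{972}>0$, so the kernel $\Psi_{PR}$ is non-degenerate, and $$\sqrt n\,I_n^{PR}\longrightarrow N\big(0,\tfrac{5}{108}\big)\quad\text{in distribution as } n\to\infty .$$ -/

import Mathlib

open MeasureTheory ProbabilityTheory Filter
open scoped ENNReal NNReal Topology

namespace PuriRubin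

/-- `μ` belongs to the family of power function distributions with parameter `lam`:
its distribution function is `F(x) = x ^ lam` for `x ∈ (0, 1)`. (This forces a probability measure
`μ` to be concentrated on `(0, 1)`.) -/
def IsPowerLaw (lam : ℝ) (μ : Measure ℝ) : Prop :=
  0 < lam ∧ ∀ x ∈ Set.Ioo (0 : ℝ) 1, cdf μ x = x ^ lam

/-- The empirical distribution function `F_n(t) = n⁻¹ ∑_{i} 1{x_i < t}` of the first `n` terms
of the sequence `x`. -/
noncomputable def empDF (x : ℕ → ℝ) (n : ℕ) (t : ℝ) : ℝ :=
  (n : ℝ)⁻¹ * ∑ i ∈ Finset.range n, if x i < t then 1 else 0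

/-- The measure `dF_n`: mass `1 / n` at each of the first `n` observations. -/
noncomputable def empMeasure (x : ℕ → ℝ) (n : ℕ) : Measure ℝ :=
  (n : ℝ≥0∞)⁻¹ • ∑ i ∈ Finset.range n, Measure.dirac (x i)

/-- The `U`-empirical distribution function
`H_n(t) = (n choose 2)⁻¹ ∑_{i < j} 1{min (x_i / x_j) (x_j / x_i) < t}`. -/
noncomputable def uEmpDF (x : ℕ → ℝ) (n : ℕ) (t : ℝ) : ℝ :=
  (n.choose 2 : ℝ)⁻¹ *
    ∑ j ∈ Finset.range n, ∑ i ∈ Finset.range j,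
      if min (x i / x j) (x j / x i) < t then 1 else 0

/-- The integral statistic `I_n = ∫_0^1 (H_n(t) - F_n(t)) dF_n(t)`. -/
noncomputable def integralStat (x : ℕ → ℝ) (n : ℕ) : ℝ :=
  ∫ t in Set.Ioo (0 : ℝ) 1, (uEmpDF x n t - empDF x n t) ∂(empMeasure x n)

/-- The symmetric, centred kernel of degree three associated with `I_n`. -/
noncomputable def kernelPR (x y z : ℝ) : ℝ :=
  (1 / 3) * ((if min (x / y) (y / x) < z then 1 else 0)
    + (if min (x / z) (z / x) < y then 1 else 0)
    + (if min (y / z) (z / y) < x then 1 else 0)) - 1 / 2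

/-- The projection `ψ(s) = E Ψ(s, Y, Z)`, with `Y`, `Z` independent of law `μ`, of a kernel `Ψ`
of degree three. -/
noncomputable def projection (Ψ : ℝ → ℝ → ℝ → ℝ) (μ : Measure ℝ) (s : ℝ) : ℝ :=
  ∫ p : ℝ × ℝ, Ψ s p.1 p.2 ∂(μ.prod μ)

/-- A kernel is non-degenerate under `μ` if its projection has positive variance. -/
def IsNonDegenerate (Ψ : ℝ → ℝ → ℝ → ℝ) (μ : Measure ℝ) : Prop :=
  0 < Var[projection Ψ μ; μ]

end PuriRubin

namespace PuriRubin

/-! ### Integrating out two independent coordinates. -/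

section Independence

variable {Ω : Type*} [MeasurableSpace Ω] {P : Measure Ω} {X : ℕ → Ω → ℝ}

/-! Almost surely all observations lie in `(0, 1)` and there are no ties. Then `∫ F_n dF_n` is
deterministic and `∫ H_n dF_n` is a normalised sum of `ratioInd (X i) (X j) (X k)` over all triples
(`integralStat_eq_sum`). Subtracting from `ratioInd` its projections onto single variables leaves
the kernel `residual`, while the projections themselves add up to the i.i.d. sum of `3 * ψ(X i)`.

The residual has zero mean given any one of its arguments, so two of its terms are uncorrelated
unless their index triples share at least two indices. About `n ^ 4` pairs of triples do, hence the
sum of residuals over distinct triples has second moment `O(n ^ 4)`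
(`integral_sq_sum_distinctTriples_le`). The normalisation of `√n * I_n` divides this by order `n ^
5`, so the residual part vanishes in probability. Triples with a repeated index contribute a
negligible deterministic error. The central limit theorem and Slutsky's lemma finish the proof.

For the explicit formulas, `X ^ lam` is uniform and comparing a quotient with a third value is
invariant under powers (`ratioInd_rpow`), so everything reduces to elementary integrals over `(0,
1)`. -/

lemma indepFun_restrict_pair (hX : ∀ i, Measurable (X i)) (hindep : iIndepFun X P)
    (S : Finset ℕ) {j k : ℕ} (hj : j ∉ S) (hk : k ∉ S) :
    IndepFun (fun ω (i : S) => X i ω) (fun ω => (X j ω, X k ω)) P := by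
  have hd : Disjoint S {j, k} := by
    rw [Finset.disjoint_right]; intro a ha
    rcases Finset.mem_insert.1 ha with rfl | ha
    · exact hj
    · rw [Finset.mem_singleton.1 ha]; exact hk
  have h := hindep.indepFun_finset S {j, k} hd hX
  exact h.comp (φ := id) (ψ := fun f : (({j, k} : Finset ℕ) → ℝ) =>
    (f ⟨j, by simp⟩, f ⟨k, by simp⟩)) measurable_id (by fun_prop)

variable [IsProbabilityMeasure P]

/-- Fubini's theorem for a function of two independent random variables. -/
lemma integral_comp_of_indepFun {α β : Type*} [MeasurableSpace α] [MeasurableSpace β]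
    {A : Ω → α} {B : Ω → β} (hA : Measurable A) (hB : Measurable B) (hAB : IndepFun A B P)
    {F : α × β → ℝ} (hF : Measurable F) {C : ℝ} (hC : ∀ p, |F p| ≤ C) :
    ∫ ω, F (A ω, B ω) ∂P = ∫ ω, ∫ b, F (A ω, b) ∂(P.map B) ∂P := by
  have := Measure.isProbabilityMeasure_map (μ := P) hA.aemeasurable
  have := Measure.isProbabilityMeasure_map (μ := P) hB.aemeasurable
  have hmap := (indepFun_iff_map_prod_eq_prod_map_map hA.aemeasurable hB.aemeasurable).1 hAB
  have hint : Integrable F ((P.map A).prod (P.map B)) :=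
    Integrable.of_bound hF.aestronglyMeasurable C (ae_of_all _ hC)
  rw [← integral_map (f := F) (hA.prodMk hB).aemeasurable hF.aestronglyMeasurable, hmap,
    integral_prod _ hint, integral_map hA.aemeasurable]
  exact hint.integral_prod_left.aestronglyMeasurable

variable {μ : Measure ℝ}

lemma map_pair_eq_prod (hX : ∀ i, Measurable (X i)) (hindep : iIndepFun X P)
    (hμ : ∀ i, P.map (X i) = μ) {j k : ℕ} (hjk : j ≠ k) :
    P.map (fun ω => (X j ω, X k ω)) = μ.prod μ := by
  rw [(indepFun_iff_map_prod_eq_prod_map_map (hX j).aemeasurable (hX k).aemeasurable).1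
    (hindep.indepFun hjk), hμ, hμ]

/-- A function of `X_i, X_j, X_k` whose integral over the last two arguments vanishes is
orthogonal to every function of variables not involving `X_j, X_k`. -/
lemma integral_mul_eq_zero_of_projection_eq_zero
    (hX : ∀ i, Measurable (X i)) (hindep : iIndepFun X P)
    (hμ : ∀ i, P.map (X i) = μ) {g k : ℝ → ℝ → ℝ → ℝ}
    (hg : Measurable fun p : ℝ × ℝ × ℝ => g p.1 p.2.1 p.2.2) {C : ℝ}
    (hgC : ∀ x y z, |g x y z| ≤ C)
    (hk : Measurable fun p : ℝ × ℝ × ℝ => k p.1 p.2.1 p.2.2) (hkC : ∀ x y z, |k x y z| ≤ C)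
    (h0 : ∀ s, projection k μ s = 0) {a₁ a₂ a₃ i j l : ℕ} (hij : i ≠ j) (hil : i ≠ l)
    (hjl : j ≠ l) (hj : j ∉ ({a₁, a₂, a₃} : Finset ℕ)) (hl : l ∉ ({a₁, a₂, a₃} : Finset ℕ)) :
    ∫ ω, g (X a₁ ω) (X a₂ ω) (X a₃ ω) * k (X i ω) (X j ω) (X l ω) ∂P = 0 := by
  -- The conditioning block includes `i` whether or not it is one of the `a`'s; only `X j` and `X l`
  -- are integrated out.
  have h := integral_comp_of_indepFun (P := P)
    (A := fun ω (m : (insert i {a₁, a₂, a₃} : Finset ℕ)) => X m ω) (B := fun ω => (X j ω, X l ω))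
    (by fun_prop) (by fun_prop) (indepFun_restrict_pair hX hindep (insert i {a₁, a₂, a₃})
      (by simp only [Finset.mem_insert, not_or] at *; tauto)
      (by simp only [Finset.mem_insert, not_or] at *; tauto))
    (F := fun p => g (p.1 ⟨a₁, by simp⟩) (p.1 ⟨a₂, by simp⟩) (p.1 ⟨a₃, by simp⟩) *
      k (p.1 ⟨i, by simp⟩) p.2.1 p.2.2) ?_ (C := C * C) ?_
  · refine h.trans ?_
    simp only [map_pair_eq_prod hX hindep hμ hjl, integral_const_mul]
    have : ∀ s, ∫ p : ℝ × ℝ, k s p.1 p.2 ∂(μ.prod μ) = 0 := h0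
    simp [this]
  · refine Measurable.mul ?_ ?_
    · exact hg.comp (f := fun p : (((insert i {a₁, a₂, a₃} : Finset ℕ) → ℝ) × ℝ × ℝ) =>
        (p.1 ⟨a₁, by simp⟩, p.1 ⟨a₂, by simp⟩, p.1 ⟨a₃, by simp⟩)) (by fun_prop)
    · exact hk.comp (f := fun p : (((insert i {a₁, a₂, a₃} : Finset ℕ) → ℝ) × ℝ × ℝ) =>
        (p.1 ⟨i, by simp⟩, p.2.1, p.2.2)) (by fun_prop)
  · intro p
    rw [abs_mul]
    exact mul_le_mul (hgC _ _ _) (hkC _ _ _) (abs_nonneg _) ((abs_nonneg _).trans (hgC 0 0 0))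

end Independence

/-! ### Second moments of sums of degenerate kernels. -/

section DegenerateSums

/-- Triples of pairwise distinct indices below `n`. -/
def distinctTriples (n : ℕ) : Finset (ℕ × ℕ × ℕ) :=
  {a ∈ Finset.range n ×ˢ Finset.range n ×ˢ Finset.range n |
    a.1 ≠ a.2.1 ∧ a.1 ≠ a.2.2 ∧ a.2.1 ≠ a.2.2}

lemma card_distinctTriples_le (n : ℕ) : (distinctTriples n).card ≤ n ^ 3 := by
  refine (Finset.card_filter_le _ _).trans (le_of_eq ?_)
  simp; ring

/-- Triples below `n` with at least two entries in `A`. -/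
def overlapTriples (A : Finset ℕ) (n : ℕ) : Finset (ℕ × ℕ × ℕ) :=
  A ×ˢ A ×ˢ Finset.range n ∪ (A ×ˢ Finset.range n ×ˢ A ∪ Finset.range n ×ˢ A ×ˢ A)

/-- Three choices of the free position, at most `3 * 3` fillings from `A` of the other two, and `n`
values for the free one. -/
lemma card_overlapTriples_le {A : Finset ℕ} (hA : A.card ≤ 3) (n : ℕ) :
    (overlapTriples A n).card ≤ 27 * n := by
  have h : A.card * A.card ≤ 9 := by nlinarith
  refine (Finset.card_union_le _ _).trans ?_
  refine (Nat.add_le_add_left (Finset.card_union_le _ _) _).trans ?_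
  simp only [Finset.card_product, Finset.card_range]
  nlinarith

variable {Ω : Type*} [MeasurableSpace Ω] {P : Measure Ω} [IsProbabilityMeasure P]
  {X : ℕ → Ω → ℝ} {μ : Measure ℝ}

/-- The second moment of the sum of a completely degenerate bounded kernel of degree three over
distinct triples is of order `n ^ 4`. -/
lemma integral_sq_sum_distinctTriples_le
    (hX : ∀ i, Measurable (X i)) (hindep : iIndepFun X P)
    (hμ : ∀ i, P.map (X i) = μ) {g : ℝ → ℝ → ℝ → ℝ}
    (hg : Measurable fun p : ℝ × ℝ × ℝ => g p.1 p.2.1 p.2.2) {C : ℝ}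
    (hgC : ∀ x y z, |g x y z| ≤ C)
    (h₁ : ∀ s, projection g μ s = 0)
    (h₂ : ∀ s, projection (fun s x z => g x s z) μ s = 0)
    (h₃ : ∀ s, projection (fun s x y => g x y s) μ s = 0) (n : ℕ) :
    ∫ ω, (∑ a ∈ distinctTriples n, g (X a.1 ω) (X a.2.1 ω) (X a.2.2 ω)) ^ 2 ∂P
      ≤ 27 * C ^ 2 * n ^ 4 := by
  have hC0 : 0 ≤ C := (abs_nonneg _).trans (hgC 0 0 0)
  set G : ℕ × ℕ × ℕ → Ω → ℝ := fun a ω => g (X a.1 ω) (X a.2.1 ω) (X a.2.2 ω) with hG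
  have hGm : ∀ a, Measurable (G a) := fun a =>
    hg.comp (f := fun ω => (X a.1 ω, X a.2.1 ω, X a.2.2 ω)) (by fun_prop)
  have hb : ∀ a b ω, |G a ω * G b ω| ≤ C ^ 2 := fun a b ω => by
    rw [abs_mul, sq]
    exact mul_le_mul (hgC _ _ _) (hgC _ _ _) (abs_nonneg _) hC0
  have hint : ∀ a b, Integrable (fun ω => G a ω * G b ω) P := fun a b =>
    Integrable.of_bound ((hGm a).mul (hGm b)).aestronglyMeasurable _ (ae_of_all _ (hb a b))
  have hexp : ∫ ω, (∑ a ∈ distinctTriples n, G a ω) ^ 2 ∂P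
      = ∑ a ∈ distinctTriples n, ∑ b ∈ distinctTriples n, ∫ ω, G a ω * G b ω ∂P := by
    simp_rw [sq, Finset.sum_mul_sum]
    rw [integral_finsetSum _ fun a _ => integrable_finsetSum _ fun b _ => hint a b]
    exact Finset.sum_congr rfl fun a _ => integral_finsetSum _ fun b _ => hint a b
  have hrow : ∀ a ∈ distinctTriples n,
      ∑ b ∈ distinctTriples n, ∫ ω, G a ω * G b ω ∂P ≤ 27 * n * C ^ 2 := by
    intro a _
    set A : Finset ℕ := {a.1, a.2.1, a.2.2} with hA
    have hterm : ∀ b ∈ distinctTriples n, ∫ ω, G a ω * G b ω ∂P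
        ≤ if b ∈ overlapTriples A n then C ^ 2 else 0 := by
      intro b hbT
      simp only [distinctTriples, Finset.mem_filter, Finset.mem_product] at hbT
      obtain ⟨⟨hr1, hr2, hr3⟩, h12, h13, h23⟩ := hbT
      split_ifs with hov
      · calc ∫ ω, G a ω * G b ω ∂P ≤ ∫ _, C ^ 2 ∂P :=
              integral_mono (hint a b) (integrable_const _) fun ω => (le_abs_self _).trans (hb a b ω)
          _ = C ^ 2 := by simp
      · simp only [overlapTriples, Finset.mem_union, Finset.mem_product, not_or, not_and] at hov
        -- At most one index of `b` lies in `A`. That variable is kept (the third one if neither of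
        -- the first two is in `A`) and the other two are integrated out.
        by_cases m1 : b.1 ∈ A
        · have m2 : b.2.1 ∉ A := fun m2 => by tauto
          have m3 : b.2.2 ∉ A := fun m3 => by tauto
          exact (integral_mul_eq_zero_of_projection_eq_zero hX hindep hμ hg hgC hg hgC h₁
            h12 h13 h23 m2 m3).le
        · by_cases m2 : b.2.1 ∈ A
          · have m3 : b.2.2 ∉ A := fun m3 => by tauto
            exact (integral_mul_eq_zero_of_projection_eq_zero hX hindep hμ hg hgC
              (k := fun s x z => g x s z)
              (hg.comp (f := fun p : ℝ × ℝ × ℝ => (p.2.1, p.1, p.2.2)) (by fun_prop))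
              (fun _ _ _ => hgC _ _ _) h₂ h12.symm h23 h13 m1 m3).le
          · exact (integral_mul_eq_zero_of_projection_eq_zero hX hindep hμ hg hgC
              (k := fun s x y => g x y s)
              (hg.comp (f := fun p : ℝ × ℝ × ℝ => (p.2.1, p.2.2, p.1)) (by fun_prop))
              (fun _ _ _ => hgC _ _ _) h₃ h13.symm h23.symm h12 m1 m2).le
    refine (Finset.sum_le_sum hterm).trans ?_
    rw [← Finset.sum_filter, Finset.sum_const, nsmul_eq_mul]
    refine mul_le_mul_of_nonneg_right ?_ (sq_nonneg _)
    have hcard : ({b ∈ distinctTriples n | b ∈ overlapTriples A n}).card ≤ 27 * n :=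
      (Finset.card_le_card fun b hb => (Finset.mem_filter.1 hb).2).trans
        (card_overlapTriples_le Finset.card_le_three n)
    exact_mod_cast hcard
  calc ∫ ω, (∑ a ∈ distinctTriples n, G a ω) ^ 2 ∂P
      ≤ ∑ a ∈ distinctTriples n, 27 * n * C ^ 2 := hexp ▸ Finset.sum_le_sum hrow
    _ = (distinctTriples n).card * (27 * n * C ^ 2) := by rw [Finset.sum_const, nsmul_eq_mul]
    _ ≤ (n : ℝ) ^ 3 * (27 * n * C ^ 2) := by
        gcongr
        exact_mod_cast card_distinctTriples_le n
    _ = 27 * C ^ 2 * n ^ 4 := by ring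

end DegenerateSums

/-! ### Power function laws as images of the uniform law. -/

section PowerLaw

variable {lam : ℝ} {μ ν : Measure ℝ}

/-- The cdf is prescribed only inside `(0, 1)`; monotonicity and the limit of `y ^ lam` at the
endpoint force its values outside. -/
lemma IsPowerLaw.cdf_of_nonpos (h : IsPowerLaw lam μ) {x : ℝ} (hx : x ≤ 0) : cdf μ x = 0 := by
  refine le_antisymm ?_ (cdf_nonneg _ _)
  have hc : Tendsto (fun y : ℝ => y ^ lam) (𝓝[>] 0) (𝓝 0) := by
    have := (Real.continuousAt_rpow_const 0 lam (Or.inr h.1.le)).tendsto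
    rw [Real.zero_rpow h.1.ne'] at this
    exact this.mono_left nhdsWithin_le_nhds
  refine ge_of_tendsto hc ?_
  filter_upwards [Ioo_mem_nhdsGT one_pos] with y hy
  rw [← h.2 y hy]
  exact monotone_cdf μ (hx.trans hy.1.le)

lemma IsPowerLaw.cdf_of_one_le (h : IsPowerLaw lam μ) {x : ℝ} (hx : 1 ≤ x) : cdf μ x = 1 := by
  refine le_antisymm (cdf_le_one _ _) ?_
  have hc : Tendsto (fun y : ℝ => y ^ lam) (𝓝[<] 1) (𝓝 1) := by
    have := (Real.continuousAt_rpow_const 1 lam (Or.inr h.1.le)).tendsto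
    rw [Real.one_rpow] at this
    exact this.mono_left nhdsWithin_le_nhds
  refine le_of_tendsto hc ?_
  filter_upwards [Ioo_mem_nhdsLT one_pos] with y hy
  rw [← h.2 y hy]
  exact monotone_cdf μ (hy.2.le.trans hx)

lemma IsPowerLaw.unique [IsProbabilityMeasure μ] [IsProbabilityMeasure ν]
    (hμ : IsPowerLaw lam μ) (hν : IsPowerLaw lam ν) : μ = ν := by
  refine Measure.eq_of_cdf μ ν (StieltjesFunction.ext fun x => ?_)
  rcases le_or_gt x 0 with h0 | h0
  · rw [hμ.cdf_of_nonpos h0, hν.cdf_of_nonpos h0]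
  rcases le_or_gt 1 x with h1 | h1
  · rw [hμ.cdf_of_one_le h1, hν.cdf_of_one_le h1]
  · rw [hμ.2 x ⟨h0, h1⟩, hν.2 x ⟨h0, h1⟩]

/-- The uniform distribution on `(0, 1)`. -/
noncomputable abbrev unif : Measure ℝ := volume.restrict (Set.Ioo 0 1)

instance : IsProbabilityMeasure unif := ⟨by simp⟩

lemma measurable_rpow_const (r : ℝ) : Measurable fun u : ℝ => u ^ r := by fun_prop

/-- Quantile transform. With `IsPowerLaw.unique` it turns every expectation into an integral over
`(0, 1)`. -/
lemma isPowerLaw_map_unif (h : 0 < lam) : IsPowerLaw lam (unif.map fun u => u ^ lam⁻¹) := by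
  have := Measure.isProbabilityMeasure_map (μ := unif) (measurable_rpow_const lam⁻¹).aemeasurable
  refine ⟨h, fun x hx => ?_⟩
  rw [cdf_eq_real, map_measureReal_apply (measurable_rpow_const _) measurableSet_Iic,
    measureReal_restrict_apply (measurable_rpow_const _ measurableSet_Iic)]
  have : ((fun u : ℝ => u ^ lam⁻¹) ⁻¹' Set.Iic x) ∩ Set.Ioo 0 1 = Set.Ioc 0 (x ^ lam) := by
    ext u
    simp only [Set.mem_inter_iff, Set.mem_preimage, Set.mem_Iic, Set.mem_Ioo, Set.mem_Ioc]
    constructor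
    · rintro ⟨h1, h2, -⟩
      exact ⟨h2, (Real.rpow_inv_le_iff_of_pos h2.le hx.1.le h).1 h1⟩
    · rintro ⟨h1, h2⟩
      exact ⟨(Real.rpow_inv_le_iff_of_pos h1.le hx.1.le h).2 h2, h1,
        h2.trans_lt (Real.rpow_lt_one hx.1.le hx.2 h)⟩
  rw [this]
  simp [Real.rpow_nonneg hx.1.le]

lemma IsPowerLaw.eq_map_unif [IsProbabilityMeasure μ] (h : IsPowerLaw lam μ) :
    μ = unif.map fun u => u ^ lam⁻¹ := by
  have := Measure.isProbabilityMeasure_map (μ := unif) (measurable_rpow_const lam⁻¹).aemeasurable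
  exact h.unique (isPowerLaw_map_unif h.1)

lemma IsPowerLaw.integral_eq [IsProbabilityMeasure μ] (h : IsPowerLaw lam μ) {f : ℝ → ℝ}
    (hf : Measurable f) : ∫ x, f x ∂μ = ∫ u, f (u ^ lam⁻¹) ∂unif := by
  conv_lhs => rw [h.eq_map_unif]
  exact integral_map (measurable_rpow_const _).aemeasurable hf.aestronglyMeasurable

lemma IsPowerLaw.integral_comp_rpow [IsProbabilityMeasure μ] (h : IsPowerLaw lam μ) {f : ℝ → ℝ}
    (hf : Measurable f) : ∫ x, f (x ^ lam) ∂μ = ∫ u, f u ∂unif := by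
  rw [h.integral_eq (f := fun x => f (x ^ lam)) (hf.comp (measurable_rpow_const _))]
  refine setIntegral_congr_fun measurableSet_Ioo fun u hu => ?_
  simp only [Real.rpow_inv_rpow hu.1.le h.1.ne']

lemma IsPowerLaw.ae_mem_Ioo [IsProbabilityMeasure μ] (h : IsPowerLaw lam μ) :
    ∀ᵐ x ∂μ, x ∈ Set.Ioo (0 : ℝ) 1 := by
  rw [h.eq_map_unif]
  refine (ae_map_iff (measurable_rpow_const _).aemeasurable measurableSet_Ioo).2 ?_
  filter_upwards [ae_restrict_mem measurableSet_Ioo] with u hu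
  exact ⟨Real.rpow_pos_of_pos hu.1 _, Real.rpow_lt_one hu.1.le hu.2 (inv_pos.2 h.1)⟩

lemma IsPowerLaw.measure_singleton [IsProbabilityMeasure μ] (h : IsPowerLaw lam μ) (x : ℝ) :
    μ {x} = 0 := by
  rw [h.eq_map_unif, Measure.map_apply (measurable_rpow_const _) (measurableSet_singleton x),
    Measure.restrict_apply (measurable_rpow_const _ (measurableSet_singleton x))]
  refine Set.Subsingleton.measure_zero ?_ _
  rintro u ⟨hu, hu'⟩ v ⟨hv, hv'⟩
  exact (Real.rpow_left_inj hu'.1.le hv'.1.le (inv_ne_zero h.1.ne')).1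
    ((Set.mem_singleton_iff.1 hu).trans (Set.mem_singleton_iff.1 hv).symm)

end PowerLaw

/-! ### Projections of the ratio indicator. -/

section RatioKernel

/-- The indicator of `min (x / y) (y / x) < z`. -/
noncomputable def ratioInd (x y z : ℝ) : ℝ := if min (x / y) (y / x) < z then 1 else 0

lemma measurable_ratioInd : Measurable fun p : ℝ × ℝ × ℝ => ratioInd p.1 p.2.1 p.2.2 :=
  Measurable.ite (measurableSet_lt (by fun_prop) (by fun_prop)) measurable_const measurable_const

lemma ratioInd_comm (x y z : ℝ) : ratioInd x y z = ratioInd y x z := by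
  rw [ratioInd, ratioInd, min_comm]

lemma ratioInd_nonneg (x y z : ℝ) : 0 ≤ ratioInd x y z := by
  rw [ratioInd]; split_ifs <;> norm_num

lemma ratioInd_le_one (x y z : ℝ) : ratioInd x y z ≤ 1 := by
  rw [ratioInd]; split_ifs <;> norm_num

lemma abs_ratioInd_le_one (x y z : ℝ) : |ratioInd x y z| ≤ 1 := by
  rw [abs_of_nonneg (ratioInd_nonneg x y z)]; exact ratioInd_le_one x y z

/-- Powers commute with quotients and preserve order. This is why the projections depend on `lam`
only through `s ^ lam`. -/
lemma ratioInd_rpow {r x y z : ℝ} (hr : 0 < r) (hx : 0 < x) (hy : 0 < y) (hz : 0 ≤ z) :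
    ratioInd (x ^ r) (y ^ r) (z ^ r) = ratioInd x y z := by
  have : min (x ^ r / y ^ r) (y ^ r / x ^ r) < z ^ r ↔ min (x / y) (y / x) < z := by
    rw [min_lt_iff, min_lt_iff, ← Real.div_rpow hx.le hy.le, ← Real.div_rpow hy.le hx.le,
      Real.rpow_lt_rpow_iff (by positivity) hz hr, Real.rpow_lt_rpow_iff (by positivity) hz hr]
  simp only [ratioInd, this]

lemma integral_unif_gt {m : ℝ} (h0 : 0 ≤ m) :
    ∫ w, (if m < w then (1 : ℝ) else 0) ∂unif = 1 - min 1 m := by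
  have : (fun w : ℝ => if m < w then (1 : ℝ) else 0) = (Set.Ioi m).indicator 1 := by
    ext w; simp [Set.indicator_apply]
  rw [this, integral_indicator_one measurableSet_Ioi,
    measureReal_restrict_apply measurableSet_Ioi]
  have : Set.Ioi m ∩ Set.Ioo 0 1 = Set.Ioo m 1 := by
    ext w; simp only [Set.mem_inter_iff, Set.mem_Ioi, Set.mem_Ioo]
    exact ⟨fun h => ⟨h.1, h.2.2⟩, fun h => ⟨h.1, h0.trans_lt h.1, h.2⟩⟩
  rw [this, Measure.real, Real.volume_Ioo]
  rcases le_total m 1 with h | h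
  · rw [min_eq_right h, ENNReal.toReal_ofReal (by linarith)]
  · rw [min_eq_left h, ENNReal.ofReal_of_nonpos (by linarith)]; simp

lemma integral_unif_lt {m : ℝ} (h0 : 0 ≤ m) (h1 : m ≤ 1) :
    ∫ w, (if w < m then (1 : ℝ) else 0) ∂unif = m := by
  have : (fun w : ℝ => if w < m then (1 : ℝ) else 0) = (Set.Iio m).indicator 1 := by
    ext w; simp [Set.indicator_apply]
  rw [this, integral_indicator_one measurableSet_Iio,
    measureReal_restrict_apply measurableSet_Iio]
  have : Set.Iio m ∩ Set.Ioo 0 1 = Set.Ioo 0 m := by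
    ext w; simp only [Set.mem_inter_iff, Set.mem_Iio, Set.mem_Ioo]
    exact ⟨fun h => ⟨h.2.1, h.1⟩, fun h => ⟨h.2, h.1, h.2.trans_le h1⟩⟩
  rw [this, Measure.real, Real.volume_Ioo, ENNReal.toReal_ofReal (by linarith), sub_zero]

lemma integral_unif_eq (f : ℝ → ℝ) : ∫ u, f u ∂unif = ∫ u in (0 : ℝ)..1, f u := by
  rw [intervalIntegral.integral_of_le zero_le_one, integral_Ioc_eq_integral_Ioo]

/-- At `v = u` the smaller quotient switches from `v / u` to `u / v`; the second piece produces the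
logarithm. -/
lemma integral_unif_min_div {u : ℝ} (h0 : 0 < u) (h1 : u ≤ 1) :
    ∫ v, (1 - min 1 (min (u / v) (v / u))) ∂unif = 1 - u / 2 + u * Real.log u := by
  have e1 : Set.EqOn (fun v => 1 - min 1 (min (u / v) (v / u))) (fun v => 1 - v * u⁻¹)
      (Set.uIcc 0 u) := by
    intro v hv
    rw [Set.uIcc_of_le h0.le] at hv
    have hvu : v / u ≤ 1 := (div_le_one h0).2 hv.2
    have : min (u / v) (v / u) = v / u := by
      rcases hv.1.eq_or_lt with rfl | hv0
      · simp
      · exact min_eq_right (hvu.trans ((one_le_div hv0).2 hv.2))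
    change 1 - min 1 (min (u / v) (v / u)) = _
    rw [this, min_eq_right hvu, div_eq_mul_inv]
  have e2 : Set.EqOn (fun v => 1 - min 1 (min (u / v) (v / u))) (fun v => 1 - u * (1 / v))
      (Set.uIcc u 1) := by
    intro v hv
    rw [Set.uIcc_of_le h1] at hv
    have hv0 : 0 < v := h0.trans_le hv.1
    have huv : u / v ≤ 1 := (div_le_one hv0).2 hv.1
    have : min (u / v) (v / u) = u / v := min_eq_left (huv.trans ((one_le_div h0).2 hv.1))
    change 1 - min 1 (min (u / v) (v / u)) = 1 - u * (1 / v)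
    rw [this, min_eq_right huv, mul_one_div]
  have hnot : (0 : ℝ) ∉ Set.uIcc u 1 := by
    rw [Set.uIcc_of_le h1]; exact fun h => absurd h.1 (not_le.2 h0)
  have i2 : IntervalIntegrable (fun v : ℝ => 1 / v) volume u 1 :=
    intervalIntegral.intervalIntegrable_one_div (fun v hv h => hnot (h ▸ hv)) continuousOn_id
  have i1' : IntervalIntegrable (fun v => 1 - v * u⁻¹) volume 0 u :=
    (by fun_prop : Continuous fun v => 1 - v * u⁻¹).intervalIntegrable _ _
  have i2' : IntervalIntegrable (fun v => 1 - u * (1 / v)) volume u 1 :=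
    intervalIntegrable_const.sub (i2.const_mul u)
  rw [integral_unif_eq, ← intervalIntegral.integral_add_adjacent_intervals
    (i1'.congr (fun v hv => (e1 (Set.uIoc_subset_uIcc hv)).symm))
    (i2'.congr (fun v hv => (e2 (Set.uIoc_subset_uIcc hv)).symm)),
    intervalIntegral.integral_congr e1, intervalIntegral.integral_congr e2,
    intervalIntegral.integral_sub intervalIntegrable_const
      ((by fun_prop : Continuous fun v => v * u⁻¹).intervalIntegrable _ _),
    intervalIntegral.integral_sub intervalIntegrable_const (i2.const_mul u),
    intervalIntegral.integral_const_mul, integral_one_div hnot]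
  simp only [intervalIntegral.integral_const, smul_eq_mul,
    intervalIntegral.integral_mul_const, integral_id, one_div, Real.log_inv]
  field_simp
  ring

/-- The integrand is the length of the `y` in `(0, 1)` with `min (x / y) (y / x) < t`, a disjoint
union of `y < t * x` and `x / t < y`. -/
lemma integral_unif_lt_or_gt {t : ℝ} (h0 : 0 < t) (h1 : t ≤ 1) :
    ∫ x, (t * x + (1 - min 1 (x / t))) ∂unif = t := by
  have e1 : Set.EqOn (fun x => t * x + (1 - min 1 (x / t))) (fun x => t * x + 1 - x * t⁻¹)
      (Set.uIcc 0 t) := by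
    intro x hx
    rw [Set.uIcc_of_le h0.le] at hx
    change t * x + (1 - min 1 (x / t)) = _
    rw [min_eq_right ((div_le_one h0).2 hx.2), div_eq_mul_inv]
    ring
  have e2 : Set.EqOn (fun x => t * x + (1 - min 1 (x / t))) (fun x => t * x) (Set.uIcc t 1) := by
    intro x hx
    rw [Set.uIcc_of_le h1] at hx
    change t * x + (1 - min 1 (x / t)) = _
    rw [min_eq_left ((one_le_div h0).2 hx.1)]
    ring
  have hm : ∀ a b : ℝ, ∫ x in a..b, t * x = t * ((b ^ 2 - a ^ 2) / 2) := fun a b => by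
    rw [intervalIntegral.integral_const_mul, integral_id]
  have hc : Continuous fun x => t * x + (1 - min 1 (x / t)) := by fun_prop
  rw [integral_unif_eq, ← intervalIntegral.integral_add_adjacent_intervals
    (hc.intervalIntegrable 0 t) (hc.intervalIntegrable t 1),
    intervalIntegral.integral_congr e1, intervalIntegral.integral_congr e2,
    intervalIntegral.integral_sub
      ((by fun_prop : Continuous fun x => t * x + 1).intervalIntegrable _ _)
      ((by fun_prop : Continuous fun x => x * t⁻¹).intervalIntegrable _ _),
    intervalIntegral.integral_add
      ((by fun_prop : Continuous fun x => t * x).intervalIntegrable _ _)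
      intervalIntegrable_const]
  simp only [intervalIntegral.integral_const, smul_eq_mul, hm,
    intervalIntegral.integral_mul_const, integral_id]
  field_simp
  ring

variable {lam : ℝ} {μ : Measure ℝ} [IsProbabilityMeasure μ]

lemma projection_eq_iterated {k : ℝ → ℝ → ℝ → ℝ}
    (hk : Measurable fun p : ℝ × ℝ × ℝ => k p.1 p.2.1 p.2.2) {C : ℝ}
    (hkC : ∀ x y z, |k x y z| ≤ C) (s : ℝ) :
    projection k μ s = ∫ x, ∫ y, k s x y ∂μ ∂μ := by
  refine integral_prod _ (Integrable.of_bound ?_ C (ae_of_all _ fun p => hkC _ _ _))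
  exact (hk.comp (f := fun p : ℝ × ℝ => (s, p)) (by fun_prop)).aestronglyMeasurable

lemma IsPowerLaw.projection_eq (h : IsPowerLaw lam μ) {k : ℝ → ℝ → ℝ → ℝ}
    (hk : Measurable fun p : ℝ × ℝ × ℝ => k p.1 p.2.1 p.2.2) {C : ℝ}
    (hkC : ∀ x y z, |k x y z| ≤ C) (s : ℝ) :
    projection k μ s = ∫ u, ∫ v, k s (u ^ lam⁻¹) (v ^ lam⁻¹) ∂unif ∂unif := by
  rw [projection_eq_iterated hk hkC]
  have hm : Measurable fun x => ∫ y, k s x y ∂μ :=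
    (StronglyMeasurable.integral_prod_right'
      (hk.comp (f := fun p : ℝ × ℝ => (s, p)) (by fun_prop)).stronglyMeasurable).measurable
  rw [h.integral_eq hm]
  congr 1 with u
  exact h.integral_eq
    (hk.comp (f := fun y : ℝ => (s, u ^ lam⁻¹, y)) (by fun_prop))

lemma IsPowerLaw.projection_ratioInd (h : IsPowerLaw lam μ) {s : ℝ} (hs : s ∈ Set.Icc (0 : ℝ) 1) :
    projection ratioInd μ s = 1 - s ^ lam / 2 + s ^ lam * Real.log (s ^ lam) := by
  rw [h.projection_eq measurable_ratioInd abs_ratioInd_le_one]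
  -- At `s = 0` both quotients are `0` (division by zero gives `0`), so the indicator is `1`,
  -- matching the formula since `0 * log 0 = 0`.
  rcases hs.1.eq_or_lt with rfl | hs0
  · rw [Real.zero_rpow h.1.ne']
    have : ∀ u ∈ Set.Ioo (0 : ℝ) 1,
        ∫ v, ratioInd 0 (u ^ lam⁻¹) (v ^ lam⁻¹) ∂unif = 1 := by
      intro u _
      rw [setIntegral_congr_fun (g := fun _ => (1 : ℝ)) measurableSet_Ioo]
      · simp
      · intro v hv
        simp [ratioInd, Real.rpow_pos_of_pos hv.1]
    rw [setIntegral_congr_fun measurableSet_Ioo this]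
    simp
  · have hu0 : 0 < s ^ lam := Real.rpow_pos_of_pos hs0 _
    have hu1 : s ^ lam ≤ 1 := Real.rpow_le_one hs.1 hs.2 h.1.le
    rw [← integral_unif_min_div hu0 hu1]
    refine setIntegral_congr_fun measurableSet_Ioo fun v hv => ?_
    have hm : 0 ≤ min (s ^ lam / v) (v / s ^ lam) :=
      le_min (div_nonneg hu0.le hv.1.le) (div_nonneg hv.1.le hu0.le)
    rw [← integral_unif_gt hm]
    refine setIntegral_congr_fun measurableSet_Ioo fun w hw => ?_
    have := ratioInd_rpow (inv_pos.2 h.1) hu0 hv.1 hw.1.le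
    rwa [Real.rpow_rpow_inv hs0.le h.1.ne'] at this

lemma IsPowerLaw.projection_ratioInd_last (h : IsPowerLaw lam μ) {s : ℝ}
    (hs : s ∈ Set.Icc (0 : ℝ) 1) :
    projection (fun s x y => ratioInd x y s) μ s = s ^ lam := by
  rw [h.projection_eq (k := fun s x y => ratioInd x y s)
    (measurable_ratioInd.comp (f := fun p : ℝ × ℝ × ℝ => (p.2.1, p.2.2, p.1)) (by fun_prop))
    (fun _ _ _ => abs_ratioInd_le_one _ _ _)]
  have ht0 : 0 ≤ s ^ lam := Real.rpow_nonneg hs.1 _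
  have ht1 : s ^ lam ≤ 1 := Real.rpow_le_one hs.1 hs.2 h.1.le
  have hred : ∀ x ∈ Set.Ioo (0 : ℝ) 1, ∀ y ∈ Set.Ioo (0 : ℝ) 1,
      ratioInd (x ^ lam⁻¹) (y ^ lam⁻¹) s = ratioInd x y (s ^ lam) := by
    intro x hx y hy
    have := ratioInd_rpow (inv_pos.2 h.1) hx.1 hy.1 ht0
    rwa [Real.rpow_rpow_inv hs.1 h.1.ne'] at this
  rw [setIntegral_congr_fun measurableSet_Ioo fun x hx =>
    setIntegral_congr_fun measurableSet_Ioo (hred x hx)]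
  generalize s ^ lam = t at ht0 ht1
  rcases ht0.eq_or_lt with rfl | ht
  · have : ∀ x ∈ Set.Ioo (0 : ℝ) 1, ∫ y, ratioInd x y 0 ∂unif = 0 := by
      intro x hx
      rw [setIntegral_congr_fun (g := fun _ => (0 : ℝ)) measurableSet_Ioo]
      · simp
      · intro y hy
        have : 0 ≤ min (x / y) (y / x) :=
          le_min (div_nonneg hx.1.le hy.1.le) (div_nonneg hy.1.le hx.1.le)
        simp only [ratioInd, if_neg (not_lt.2 this)]
    rw [setIntegral_congr_fun measurableSet_Ioo this]
    simp
  · conv_rhs => rw [← integral_unif_lt_or_gt ht ht1]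
    refine setIntegral_congr_fun measurableSet_Ioo fun x hx => ?_
    have h1 : t * x ≤ 1 := mul_le_one₀ ht1 hx.1.le hx.2.le
    have hle : t * x ≤ x / t := by
      rw [le_div_iff₀ ht]; nlinarith [mul_pos ht hx.1, hx.1]
    rw [← integral_unif_lt (mul_nonneg ht.le hx.1.le) h1,
      ← integral_unif_gt (div_nonneg hx.1.le ht.le),
      ← integral_add]
    · refine setIntegral_congr_fun measurableSet_Ioo fun y hy => ?_
      have hiff : min (x / y) (y / x) < t ↔ y < t * x ∨ x / t < y := by
        rw [min_lt_iff, div_lt_comm₀ hy.1 ht, div_lt_iff₀ hx.1, or_comm]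
      simp only [ratioInd, hiff]
      by_cases c1 : y < t * x
      · have c2 : ¬ x / t < y := not_lt.2 (c1.le.trans hle)
        simp [c1, c2]
      · by_cases c2 : x / t < y <;> simp [c1, c2]
    · exact Integrable.of_bound (Measurable.ite measurableSet_Iio measurable_const
        measurable_const).aestronglyMeasurable 1 (ae_of_all _ fun y => by split_ifs <;> simp)
    · exact Integrable.of_bound (Measurable.ite measurableSet_Ioi measurable_const
        measurable_const).aestronglyMeasurable 1 (ae_of_all _ fun y => by split_ifs <;> simp)

end RatioKernel

/-! ### Moments of `u * log u` under the uniform law. -/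

section LogMoments

lemma integral_unif_id : ∫ u, u ∂unif = 1 / 2 := by
  rw [integral_unif_eq, integral_id]; norm_num

lemma integral_unif_mul_log : ∫ u, u * Real.log u ∂unif = -1 / 4 := by
  -- The antiderivative is grouped around `u * log u`, which is continuous at `0`; derivatives are
  -- then needed only in the open interval.
  rw [integral_unif_eq, intervalIntegral.integral_eq_sub_of_hasDeriv_right_of_le zero_le_one
    (f := fun u => u * (u * Real.log u) / 2 - u ^ 2 / 4)]
  · simp; norm_num
  · have := Real.continuous_mul_log
    exact (by fun_prop : Continuous fun u => u * (u * Real.log u) / 2 - u ^ 2 / 4).continuousOn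
  · intro u hu
    have h1 := ((hasDerivAt_id u).mul
      ((hasDerivAt_id u).mul (Real.hasDerivAt_log hu.1.ne'))).div_const 2
    have h2 := ((hasDerivAt_id u).pow 2).div_const 4
    have h3 := (h1.sub h2).hasDerivWithinAt (s := Set.Ioi u)
    refine h3.congr_deriv ?_
    have := hu.1.ne'
    simp
    field_simp
    ring
  · exact Real.continuous_mul_log.intervalIntegrable _ _

lemma integral_unif_mul_log_sq : ∫ u, (u * Real.log u) ^ 2 ∂unif = 2 / 27 := by
  rw [integral_unif_eq, intervalIntegral.integral_eq_sub_of_hasDeriv_right_of_le zero_le_one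
    (f := fun u => u * (u * Real.log u) ^ 2 / 3 - 2 * u ^ 2 * (u * Real.log u) / 9
      + 2 * u ^ 3 / 27)]
  · simp
  · have := Real.continuous_mul_log
    exact (by fun_prop : Continuous fun u => u * (u * Real.log u) ^ 2 / 3
      - 2 * u ^ 2 * (u * Real.log u) / 9 + 2 * u ^ 3 / 27).continuousOn
  · intro u hu
    have h0 := (hasDerivAt_id u).mul (Real.hasDerivAt_log hu.1.ne')
    have h1 := ((hasDerivAt_id u).mul (h0.pow 2)).div_const 3
    have h2 := ((((hasDerivAt_id u).pow 2).const_mul 2).mul h0).div_const 9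
    have h3 := (((hasDerivAt_id u).pow 3).const_mul 2).div_const 27
    have h4 := ((h1.sub h2).add h3).hasDerivWithinAt (s := Set.Ioi u)
    refine h4.congr_deriv ?_
    have := hu.1.ne'
    simp
    field_simp
    ring
  · exact (Real.continuous_mul_log.pow 2).intervalIntegrable _ _

end LogMoments

/-! ### The projection as a conditional expectation. -/

section ConditionalExpectation

variable {Ω : Type*} [MeasurableSpace Ω] {P : Measure Ω} [IsProbabilityMeasure P]
  {X : ℕ → Ω → ℝ} {μ : Measure ℝ}

/-- The events `X 0 ⁻¹' t` exhaust the σ-algebra of `X 0`, so this characterises the conditional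
expectation; `t = univ` gives the mean of the kernel. -/
lemma setIntegral_kernel_eq (hX : ∀ i, Measurable (X i)) (hindep : iIndepFun X P)
    (hμ : ∀ i, P.map (X i) = μ) {k : ℝ → ℝ → ℝ → ℝ}
    (hk : Measurable fun p : ℝ × ℝ × ℝ => k p.1 p.2.1 p.2.2) {C : ℝ}
    (hkC : ∀ x y z, |k x y z| ≤ C) {t : Set ℝ} (ht : MeasurableSet t) :
    ∫ ω in X 0 ⁻¹' t, k (X 0 ω) (X 1 ω) (X 2 ω) ∂P
      = ∫ ω in X 0 ⁻¹' t, projection k μ (X 0 ω) ∂P := by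
  have hind : IndepFun (X 0) (fun ω => (X 1 ω, X 2 ω)) P :=
    (hindep.indepFun_prodMk hX 1 2 0 (by norm_num) (by norm_num)).symm
  have h := integral_comp_of_indepFun (hX 0) ((hX 1).prodMk (hX 2)) hind
    (F := fun p => t.indicator 1 p.1 * k p.1 p.2.1 p.2.2)
    (((measurable_one.indicator ht).comp measurable_fst).mul hk) (C := C) (fun p => by
      rw [abs_mul]
      by_cases hp : p.1 ∈ t
      · simpa [hp] using hkC _ _ _
      · simpa [hp] using (abs_nonneg _).trans (hkC 0 0 0))
  rw [map_pair_eq_prod hX hindep hμ (by norm_num)] at h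
  simp only [integral_const_mul] at h
  rw [← integral_indicator (hX 0 ht), ← integral_indicator (hX 0 ht)]
  convert h using 2
  · ext ω; by_cases hω : X 0 ω ∈ t <;> simp [hω]
  · ext ω; by_cases hω : X 0 ω ∈ t <;> simp [hω, projection]

variable [IsProbabilityMeasure μ]

lemma measurable_projection {k : ℝ → ℝ → ℝ → ℝ}
    (hk : Measurable fun p : ℝ × ℝ × ℝ => k p.1 p.2.1 p.2.2) : Measurable (projection k μ) :=
  (StronglyMeasurable.integral_prod_right' (ν := μ.prod μ) hk.stronglyMeasurable).measurable

lemma abs_projection_le {k : ℝ → ℝ → ℝ → ℝ} {C : ℝ} (hkC : ∀ x y z, |k x y z| ≤ C) (s : ℝ) :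
    |projection k μ s| ≤ C := by
  have := norm_integral_le_of_norm_le_const (μ := μ.prod μ) (f := fun p : ℝ × ℝ => k s p.1 p.2)
    (ae_of_all _ fun p => hkC s p.1 p.2)
  rw [projection]
  simpa using this

lemma condExp_kernel_ae_eq (hX : ∀ i, Measurable (X i)) (hindep : iIndepFun X P)
    (hμ : ∀ i, P.map (X i) = μ) {k : ℝ → ℝ → ℝ → ℝ}
    (hk : Measurable fun p : ℝ × ℝ × ℝ => k p.1 p.2.1 p.2.2) {C : ℝ}
    (hkC : ∀ x y z, |k x y z| ≤ C) :
    P[fun ω => k (X 0 ω) (X 1 ω) (X 2 ω) | MeasurableSpace.comap (X 0) inferInstance]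
      =ᵐ[P] fun ω => projection k μ (X 0 ω) := by
  have hp := measurable_projection (μ := μ) hk
  have hpi : Integrable (fun ω => projection k μ (X 0 ω)) P :=
    Integrable.of_bound (hp.comp (hX 0)).aestronglyMeasurable C
      (ae_of_all _ fun ω => abs_projection_le hkC _)
  have hki : Integrable (fun ω => k (X 0 ω) (X 1 ω) (X 2 ω)) P :=
    Integrable.of_bound (hk.comp (f := fun ω => (X 0 ω, X 1 ω, X 2 ω))
      (by fun_prop)).aestronglyMeasurable C (ae_of_all _ fun ω => hkC _ _ _)
  refine (ae_eq_condExp_of_forall_setIntegral_eq (hX 0).comap_le hki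
    (fun _ _ _ => hpi.integrableOn) ?_ ?_).symm
  · rintro _ ⟨t, ht, rfl⟩ -
    exact (setIntegral_kernel_eq hX hindep hμ hk hkC ht).symm
  · exact (hp.comp (comap_measurable (X 0))).aestronglyMeasurable

end ConditionalExpectation

/-! ### Mean, variance and residual of the symmetric kernel. -/

section Kernel

/-- The kernel `1{min (x / y) (y / x) < z}` minus its first-order projections. -/
noncomputable def residual (μ : Measure ℝ) (x y z : ℝ) : ℝ :=
  ratioInd x y z - projection ratioInd μ x - projection ratioInd μ y
    - projection (fun s x y => ratioInd x y s) μ z + 1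

variable {lam : ℝ} {μ : Measure ℝ}

lemma residual_comm (x y z : ℝ) : residual μ x y z = residual μ y x z := by
  rw [residual, residual, ratioInd_comm]; ring

variable [IsProbabilityMeasure μ]

lemma measurable_ratioInd_last :
    Measurable fun p : ℝ × ℝ × ℝ => ratioInd p.2.1 p.2.2 p.1 :=
  measurable_ratioInd.comp (f := fun p : ℝ × ℝ × ℝ => (p.2.1, p.2.2, p.1)) (by fun_prop)

lemma kernelPR_eq (x y z : ℝ) : kernelPR x y z
    = (1 / 3) * (ratioInd x y z + ratioInd x z y + ratioInd y z x) - 1 / 2 := rfl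

lemma measurable_kernelPR : Measurable fun p : ℝ × ℝ × ℝ => kernelPR p.1 p.2.1 p.2.2 := by
  simp only [kernelPR_eq]
  have h : Measurable fun p : ℝ × ℝ × ℝ => ratioInd p.1 p.2.2 p.2.1 :=
    measurable_ratioInd.comp (f := fun p : ℝ × ℝ × ℝ => (p.1, p.2.2, p.2.1)) (by fun_prop)
  exact (((measurable_ratioInd.add h).add measurable_ratioInd_last).const_mul _).sub_const _

lemma abs_kernelPR_le (x y z : ℝ) : |kernelPR x y z| ≤ 1 / 2 := by
  rw [kernelPR_eq, abs_le]
  have h1 := ratioInd_nonneg x y z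
  have h2 := ratioInd_nonneg x z y
  have h3 := ratioInd_nonneg y z x
  have h4 := ratioInd_le_one x y z
  have h5 := ratioInd_le_one x z y
  have h6 := ratioInd_le_one y z x
  constructor <;> linarith

lemma integrable_pair {f : ℝ × ℝ → ℝ} (hf : Measurable f) {C : ℝ} (hC : ∀ p, |f p| ≤ C) :
    Integrable f (μ.prod μ) :=
  Integrable.of_bound hf.aestronglyMeasurable C (ae_of_all _ hC)

lemma integrable_ratioInd_pair (s : ℝ) :
    Integrable (fun p : ℝ × ℝ => ratioInd s p.1 p.2) (μ.prod μ) :=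
  integrable_pair (measurable_ratioInd.comp (f := fun p : ℝ × ℝ => (s, p)) (by fun_prop))
    fun _ => abs_ratioInd_le_one _ _ _

lemma integrable_ratioInd_last_pair (s : ℝ) :
    Integrable (fun p : ℝ × ℝ => ratioInd p.1 p.2 s) (μ.prod μ) :=
  integrable_pair (measurable_ratioInd_last.comp (f := fun p : ℝ × ℝ => (s, p)) (by fun_prop))
    fun _ => abs_ratioInd_le_one _ _ _

/-- The fixed argument enters a quotient in two of the three indicators and is the threshold in the
third. -/
lemma projection_kernelPR (s : ℝ) : projection kernelPR μ s
    = (1 / 3) * (2 * projection ratioInd μ s + projection (fun s x y => ratioInd x y s) μ s)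
      - 1 / 2 := by
  have hsw : ∫ p : ℝ × ℝ, ratioInd s p.2 p.1 ∂(μ.prod μ) = projection ratioInd μ s :=
    integral_prod_swap (μ := μ) (ν := μ) (fun p : ℝ × ℝ => ratioInd s p.1 p.2)
  have hi2 : Integrable (fun p : ℝ × ℝ => ratioInd s p.2 p.1) (μ.prod μ) :=
    (integrable_ratioInd_pair (μ := μ) s).swap
  have hi1 := integrable_ratioInd_pair (μ := μ) s
  have hi3 := integrable_ratioInd_last_pair (μ := μ) s
  simp only [projection, kernelPR_eq] at hsw ⊢
  rw [integral_sub (((hi1.fun_add hi2).fun_add hi3).const_mul _) (integrable_const _),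
    integral_const_mul, integral_add (hi1.fun_add hi2) hi3, integral_add hi1 hi2, hsw]
  simp
  ring

lemma IsPowerLaw.projection_kernelPR (h : IsPowerLaw lam μ) {s : ℝ}
    (hs : s ∈ Set.Icc (0 : ℝ) 1) :
    projection kernelPR μ s = 1 / 6 + 2 / 3 * s ^ lam * Real.log (s ^ lam) := by
  rw [PuriRubin.projection_kernelPR, h.projection_ratioInd hs, h.projection_ratioInd_last hs]
  ring

lemma integrable_unif {f : ℝ → ℝ} (hf : Continuous f) : Integrable f unif :=
  (hf.integrableOn_Icc (a := 0) (b := 1)).mono_set Set.Ioo_subset_Icc_self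

lemma IsPowerLaw.integral_projection_ratioInd (h : IsPowerLaw lam μ) :
    ∫ s, projection ratioInd μ s ∂μ = 1 / 2 := by
  have hc := Real.continuous_mul_log
  rw [integral_congr_ae (g := fun s => (fun u => 1 - u / 2 + u * Real.log u) (s ^ lam)),
    h.integral_comp_rpow (f := fun u => 1 - u / 2 + u * Real.log u) (by fun_prop),
    integral_add (integrable_unif (by fun_prop)) (integrable_unif hc),
    integral_sub (integrable_const _) (integrable_unif (by fun_prop)), integral_div,
    integral_unif_id, integral_unif_mul_log]
  · simp; norm_num
  · filter_upwards [h.ae_mem_Ioo] with s hs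
    exact h.projection_ratioInd ⟨hs.1.le, hs.2.le⟩

lemma IsPowerLaw.integral_projection_ratioInd_last (h : IsPowerLaw lam μ) :
    ∫ s, projection (fun s x y => ratioInd x y s) μ s ∂μ = 1 / 2 := by
  rw [integral_congr_ae (g := fun s => (fun u => u) (s ^ lam)),
    h.integral_comp_rpow (f := fun u => u) (by fun_prop), integral_unif_id]
  filter_upwards [h.ae_mem_Ioo] with s hs
  exact h.projection_ratioInd_last ⟨hs.1.le, hs.2.le⟩

lemma integrable_projection {k : ℝ → ℝ → ℝ → ℝ}
    (hk : Measurable fun p : ℝ × ℝ × ℝ => k p.1 p.2.1 p.2.2) {C : ℝ}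
    (hkC : ∀ x y z, |k x y z| ≤ C) : Integrable (projection k μ) μ :=
  Integrable.of_bound (measurable_projection hk).aestronglyMeasurable C
    (ae_of_all _ (abs_projection_le hkC))

lemma IsPowerLaw.integral_projection_kernelPR (h : IsPowerLaw lam μ) :
    ∫ s, projection kernelPR μ s ∂μ = 0 := by
  have h1 := integrable_projection (μ := μ) measurable_ratioInd abs_ratioInd_le_one
  have h2 := integrable_projection (μ := μ) measurable_ratioInd_last
    fun s x y => abs_ratioInd_le_one x y s
  simp only [PuriRubin.projection_kernelPR]
  rw [integral_sub (((h1.const_mul 2).fun_add h2).const_mul _) (integrable_const _),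
    integral_const_mul, integral_add (h1.const_mul 2) h2, integral_const_mul,
    h.integral_projection_ratioInd, h.integral_projection_ratioInd_last]
  simp; norm_num

lemma IsPowerLaw.variance_projection_kernelPR (h : IsPowerLaw lam μ) :
    Var[projection kernelPR μ; μ] = 5 / 972 := by
  have hc := Real.continuous_mul_log
  have hc2 : Continuous fun u => (u * Real.log u) ^ 2 := hc.pow 2
  rw [variance_eq_integral (measurable_projection measurable_kernelPR).aemeasurable,
    h.integral_projection_kernelPR,
    integral_congr_ae (g := fun s => (fun u => 1 / 36 + 2 / 9 * (u * Real.log u)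
      + 4 / 9 * (u * Real.log u) ^ 2) (s ^ lam)),
    h.integral_comp_rpow (f := fun u => 1 / 36 + 2 / 9 * (u * Real.log u)
      + 4 / 9 * (u * Real.log u) ^ 2) (by fun_prop),
    integral_add (integrable_unif (by fun_prop)) ((integrable_unif hc2).const_mul _),
    integral_add (integrable_const _) ((integrable_unif hc).const_mul _),
    integral_const_mul, integral_const_mul, integral_unif_mul_log, integral_unif_mul_log_sq]
  -- `1/36 + (2/9) * (-1/4) + (4/9) * (2/27) = 5/972`.
  · simp; norm_num
  · filter_upwards [h.ae_mem_Ioo] with s hs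
    rw [h.projection_kernelPR ⟨hs.1.le, hs.2.le⟩]
    ring

lemma measurable_residual :
    Measurable fun p : ℝ × ℝ × ℝ => residual μ p.1 p.2.1 p.2.2 := by
  have h1 := measurable_projection (μ := μ) measurable_ratioInd
  have h2 := measurable_projection (μ := μ) (k := fun s x y => ratioInd x y s)
    measurable_ratioInd_last
  exact (((measurable_ratioInd.sub (h1.comp measurable_fst)).sub
    (h1.comp (measurable_fst.comp measurable_snd))).sub
    (h2.comp (measurable_snd.comp measurable_snd))).add_const 1

lemma abs_residual_le (x y z : ℝ) : |residual μ x y z| ≤ 5 := by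
  have h1 := abs_le.1 (abs_projection_le (μ := μ) abs_ratioInd_le_one x)
  have h2 := abs_le.1 (abs_projection_le (μ := μ) abs_ratioInd_le_one y)
  have h3 := abs_le.1 (abs_projection_le (μ := μ) (k := fun s x y => ratioInd x y s)
    (fun s x y => abs_ratioInd_le_one x y s) z)
  have h4 := abs_le.1 (abs_ratioInd_le_one x y z)
  rw [residual, abs_le]
  constructor <;> linarith [h1.1, h1.2, h2.1, h2.2, h3.1, h3.2, h4.1, h4.2]

/-- The projection at `s` cancels and the other two have mean `1/2`, which the constant `1` in
`residual` compensates. No formula at `s` is used, so `s` may be any real. -/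
lemma IsPowerLaw.projection_residual (h : IsPowerLaw lam μ) (s : ℝ) :
    projection (residual μ) μ s = 0 := by
  have i1 := integrable_ratioInd_pair (μ := μ) s
  have iA := (integrable_projection (μ := μ) measurable_ratioInd abs_ratioInd_le_one).comp_fst μ
  have iB := (integrable_projection (μ := μ) measurable_ratioInd_last
    fun s x y => abs_ratioInd_le_one x y s).comp_snd μ
  have e : projection (residual μ) μ s = ∫ p : ℝ × ℝ, (ratioInd s p.1 p.2
      - projection ratioInd μ s - projection ratioInd μ p.1
      - projection (fun s x y => ratioInd x y s) μ p.2 + 1) ∂(μ.prod μ) := rfl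
  have j1 : Integrable (fun p : ℝ × ℝ => ratioInd s p.1 p.2 - projection ratioInd μ s)
    (μ.prod μ) := i1.sub (integrable_const _)
  have j2 : Integrable (fun p : ℝ × ℝ => ratioInd s p.1 p.2 - projection ratioInd μ s
    - projection ratioInd μ p.1) (μ.prod μ) := j1.sub iA
  have j3 : Integrable (fun p : ℝ × ℝ => ratioInd s p.1 p.2 - projection ratioInd μ s
    - projection ratioInd μ p.1 - projection (fun s x y => ratioInd x y s) μ p.2) (μ.prod μ) :=
    j2.sub iB
  rw [e, integral_add j3 (integrable_const _), integral_sub j2 iB, integral_sub j1 iA,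
    integral_sub i1 (integrable_const _),
    integral_fun_fst, integral_fun_snd, h.integral_projection_ratioInd,
    h.integral_projection_ratioInd_last]
  simp [projection]
  norm_num

lemma IsPowerLaw.projection_residual_last (h : IsPowerLaw lam μ) (s : ℝ) :
    projection (fun s x y => residual μ x y s) μ s = 0 := by
  have i1 := integrable_ratioInd_last_pair (μ := μ) s
  have hA := integrable_projection (μ := μ) measurable_ratioInd abs_ratioInd_le_one
  have iA := hA.comp_fst μ
  have iA' := hA.comp_snd μ
  have e : projection (fun s x y => residual μ x y s) μ s = ∫ p : ℝ × ℝ, (ratioInd p.1 p.2 s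
      - projection ratioInd μ p.1 - projection ratioInd μ p.2
      - projection (fun s x y => ratioInd x y s) μ s + 1) ∂(μ.prod μ) := rfl
  have j1 : Integrable (fun p : ℝ × ℝ => ratioInd p.1 p.2 s - projection ratioInd μ p.1)
    (μ.prod μ) := i1.sub iA
  have j2 : Integrable (fun p : ℝ × ℝ => ratioInd p.1 p.2 s - projection ratioInd μ p.1
    - projection ratioInd μ p.2) (μ.prod μ) := j1.sub iA'
  have j3 : Integrable (fun p : ℝ × ℝ => ratioInd p.1 p.2 s - projection ratioInd μ p.1
    - projection ratioInd μ p.2 - projection (fun s x y => ratioInd x y s) μ s) (μ.prod μ) :=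
    j2.sub (integrable_const _)
  rw [e, integral_add j3 (integrable_const _), integral_sub j2 (integrable_const _),
    integral_sub j1 iA', integral_sub i1 iA,
    integral_fun_fst, integral_fun_snd, h.integral_projection_ratioInd]
  simp [projection]
  ring

end Kernel

/-! ### The statistic as a sum over triples. -/

section Identity

lemma empMeasure_restrict {x : ℕ → ℝ} (hx : ∀ i, x i ∈ Set.Ioo (0 : ℝ) 1) (n : ℕ) :
    (empMeasure x n).restrict (Set.Ioo 0 1) = empMeasure x n := by
  refine Measure.restrict_eq_self_of_ae_mem ?_
  rw [ae_iff]
  have hs : MeasurableSet {a : ℝ | a ∉ Set.Ioo (0 : ℝ) 1} := measurableSet_Ioo.compl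
  rw [empMeasure, Measure.smul_apply, Measure.finsetSum_apply]
  rw [Finset.sum_eq_zero, smul_zero]
  intro i _
  rw [Measure.dirac_apply' _ hs, Set.indicator_of_notMem]
  exact fun h => h (hx i)

lemma integral_empMeasure (x : ℕ → ℝ) (n : ℕ) (f : ℝ → ℝ) :
    ∫ t, f t ∂(empMeasure x n) = (n : ℝ)⁻¹ * ∑ k ∈ Finset.range n, f (x k) := by
  rw [empMeasure, integral_smul_measure, integral_finsetSum_measure]
  · simp
  · exact fun i _ => integrable_dirac (by simp)

lemma integralStat_eq_average {x : ℕ → ℝ} (hx : ∀ i, x i ∈ Set.Ioo (0 : ℝ) 1) (n : ℕ) :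
    integralStat x n
      = (n : ℝ)⁻¹ * ∑ k ∈ Finset.range n, (uEmpDF x n (x k) - empDF x n (x k)) := by
  rw [integralStat, empMeasure_restrict hx, integral_empMeasure]

lemma two_mul_sum_lt {f : ℕ → ℕ → ℝ} (hs : ∀ i j, f i j = f j i) (h0 : ∀ i, f i i = 0) (n : ℕ) :
    2 * ∑ j ∈ Finset.range n, ∑ i ∈ Finset.range j, f i j
      = ∑ i ∈ Finset.range n, ∑ j ∈ Finset.range n, f i j := by
  induction n with
  | zero => simp
  | succ n ih =>
    rw [Finset.sum_range_succ, mul_add, ih]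
    simp only [Finset.sum_range_succ, Finset.sum_add_distrib, h0, add_zero]
    rw [Finset.sum_congr rfl fun j _ => hs n j]
    ring

/-- Makes the diagonal `i = j` harmless, so `H_n` can be written as a full double sum. -/
lemma ratioInd_self {x z : ℝ} (hx : x ≠ 0) (hz : z < 1) : ratioInd x x z = 0 := by
  rw [ratioInd, div_self hx, min_self, if_neg (not_lt.2 hz.le)]

/-- Without ties each unordered pair is counted exactly once, so `∫ F_n dF_n = (n - 1) / (2 n)` is
not random. -/
lemma two_mul_sum_indicator_lt {x : ℕ → ℝ} (hinj : ∀ i j, i ≠ j → x i ≠ x j) (n : ℕ) :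
    2 * ∑ k ∈ Finset.range n, ∑ i ∈ Finset.range n, (if x i < x k then (1 : ℝ) else 0)
      = n * (n - 1) := by
  have h : ∀ k ∈ Finset.range n, ∑ i ∈ Finset.range n,
      ((if x i < x k then (1 : ℝ) else 0) + (if x k < x i then (1 : ℝ) else 0)) = n - 1 := by
    intro k hk
    have : ∀ i, ((if x i < x k then (1 : ℝ) else 0) + (if x k < x i then (1 : ℝ) else 0))
        = 1 - if i = k then 1 else 0 := by
      intro i
      rcases eq_or_ne i k with rfl | hne
      · simp
      · rcases lt_or_gt_of_ne (hinj i k hne) with h | h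
        · simp [h, h.not_gt, hne]
        · simp [h, h.not_gt, hne]
    simp only [this, Finset.sum_sub_distrib]
    simp [Finset.mem_range.1 hk]
  have h' := Finset.sum_congr (rfl : Finset.range n = Finset.range n) h
  simp only [Finset.sum_add_distrib] at h'
  rw [Finset.sum_comm (f := fun k i => if x k < x i then (1 : ℝ) else 0)] at h'
  rw [two_mul, h', Finset.sum_const, Finset.card_range, nsmul_eq_mul]

/-- In the absence of ties the integral statistic is a sum over all triples of observations. -/
lemma integralStat_eq_sum {x : ℕ → ℝ} (hx : ∀ i, x i ∈ Set.Ioo (0 : ℝ) 1)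
    (hinj : ∀ i j, i ≠ j → x i ≠ x j) {n : ℕ} (hn : 2 ≤ n) :
    (n : ℝ) ^ 2 * (n - 1) * integralStat x n
      = ∑ i ∈ Finset.range n, ∑ j ∈ Finset.range n, ∑ k ∈ Finset.range n,
          ratioInd (x i) (x j) (x k) - n * (n - 1) ^ 2 / 2 := by
  have hn0 : (n : ℝ) ≠ 0 := by positivity
  have hn1 : (n : ℝ) - 1 ≠ 0 := by
    have : (2 : ℝ) ≤ n := by exact_mod_cast hn
    linarith
  have hU : ∀ k, uEmpDF x n (x k) = ((n : ℝ) * (n - 1))⁻¹ *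
      ∑ i ∈ Finset.range n, ∑ j ∈ Finset.range n, ratioInd (x i) (x j) (x k) := by
    intro k
    rw [← two_mul_sum_lt (f := fun i j => ratioInd (x i) (x j) (x k))
      (fun i j => ratioInd_comm _ _ _) (fun i => ratioInd_self (hx i).1.ne' (hx k).2),
      uEmpDF, Nat.cast_choose_two]
    simp only [ratioInd]
    field_simp
  have hF := two_mul_sum_indicator_lt hinj n
  have hI : integralStat x n = (n : ℝ)⁻¹ * (((n : ℝ) * (n - 1))⁻¹ *
      ∑ k ∈ Finset.range n, ∑ i ∈ Finset.range n, ∑ j ∈ Finset.range n,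
        ratioInd (x i) (x j) (x k) - (n : ℝ)⁻¹ * (n * (n - 1) / 2)) := by
    rw [integralStat_eq_average hx, Finset.sum_sub_distrib]
    simp only [hU, empDF]
    rw [← Finset.mul_sum, ← Finset.mul_sum, ← hF]
    ring
  have hcomm : ∑ k ∈ Finset.range n, ∑ i ∈ Finset.range n, ∑ j ∈ Finset.range n,
      ratioInd (x i) (x j) (x k) = ∑ i ∈ Finset.range n, ∑ j ∈ Finset.range n,
        ∑ k ∈ Finset.range n, ratioInd (x i) (x j) (x k) := by
    rw [Finset.sum_comm]
    exact Finset.sum_congr rfl fun i _ => Finset.sum_comm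
  rw [hI, hcomm]
  field_simp

lemma sum_triple_split (x : ℕ → ℝ) (A B : ℝ → ℝ) (r : ℝ → ℝ → ℝ → ℝ) (n : ℕ) :
    ∑ i ∈ Finset.range n, ∑ j ∈ Finset.range n, ∑ k ∈ Finset.range n,
        (r (x i) (x j) (x k) - A (x i) - A (x j) - B (x k) + 1)
      = ∑ i ∈ Finset.range n, ∑ j ∈ Finset.range n, ∑ k ∈ Finset.range n, r (x i) (x j) (x k)
        - n ^ 2 * ∑ i ∈ Finset.range n, (2 * A (x i) + B (x i)) + n ^ 3 := by
  simp only [Finset.sum_add_distrib, Finset.sum_sub_distrib, Finset.sum_const, Finset.card_range,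
    nsmul_eq_mul, ← Finset.mul_sum]
  ring

/-- Each of the three possible coincidences of indices leaves `n ^ 2` triples. -/
lemma abs_sum_sub_sum_distinctTriples_le {f : ℕ × ℕ × ℕ → ℝ} {C : ℝ} (hf : ∀ a, |f a| ≤ C)
    (n : ℕ) :
    |∑ i ∈ Finset.range n, ∑ j ∈ Finset.range n, ∑ k ∈ Finset.range n, f (i, j, k)
      - ∑ a ∈ distinctTriples n, f a| ≤ 3 * C * n ^ 2 := by
  have hC : 0 ≤ C := (abs_nonneg _).trans (hf (0, 0, 0))
  have e1 : ∑ a ∈ distinctTriples n, f a = ∑ i ∈ Finset.range n, ∑ j ∈ Finset.range n,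
      ∑ k ∈ Finset.range n, if i ≠ j ∧ i ≠ k ∧ j ≠ k then f (i, j, k) else 0 := by
    rw [distinctTriples, Finset.sum_filter, Finset.sum_product]
    exact Finset.sum_congr rfl fun i _ => Finset.sum_product _ _ _
  rw [e1]
  simp only [← Finset.sum_sub_distrib]
  have hterm : ∀ i j k : ℕ, |f (i, j, k) - if i ≠ j ∧ i ≠ k ∧ j ≠ k then f (i, j, k) else 0|
      ≤ C * ((if i = j then 1 else 0) + (if i = k then 1 else 0) + if j = k then 1 else 0) := by
    intro i j k
    have h := hf (i, j, k)
    have hi : ∀ p : Prop, ∀ _ : Decidable p, (0 : ℝ) ≤ if p then 1 else 0 := fun p _ => by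
      split_ifs <;> norm_num
    by_cases hd : i ≠ j ∧ i ≠ k ∧ j ≠ k
    · rw [if_pos hd, sub_self, abs_zero]
      exact mul_nonneg hC (add_nonneg (add_nonneg (hi _ _) (hi _ _)) (hi _ _))
    · rw [if_neg hd, sub_zero]
      refine h.trans (le_mul_of_one_le_right hC ?_)
      have h1 := hi (i = j) inferInstance
      have h2 := hi (i = k) inferInstance
      have h3 := hi (j = k) inferInstance
      by_cases e1 : i = j
      · rw [if_pos e1]; linarith
      by_cases e2 : i = k
      · rw [if_pos e2]; linarith
      by_cases e3 : j = k
      · rw [if_pos e3]; linarith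
      exact absurd ⟨e1, e2, e3⟩ hd
  calc _ ≤ ∑ i ∈ Finset.range n, ∑ j ∈ Finset.range n, ∑ k ∈ Finset.range n,
        C * (((if i = j then 1 else 0) + (if i = k then 1 else 0)
          + if j = k then 1 else 0) : ℝ) := by
        refine (Finset.abs_sum_le_sum_abs _ _).trans (Finset.sum_le_sum fun i _ => ?_)
        refine (Finset.abs_sum_le_sum_abs _ _).trans (Finset.sum_le_sum fun j _ => ?_)
        exact (Finset.abs_sum_le_sum_abs _ _).trans (Finset.sum_le_sum fun k _ => hterm i j k)
    _ = 3 * C * n ^ 2 := by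
        have h2 : ∑ i ∈ Finset.range n, ∑ j ∈ Finset.range n,
            (if i = j then (1 : ℝ) else 0) = n := by
          rw [Finset.sum_congr rfl fun i hi => by
            rw [Finset.sum_ite_eq, if_pos hi]]
          simp
        simp only [← Finset.mul_sum, Finset.sum_add_distrib, h2, Finset.sum_const,
          Finset.card_range, nsmul_eq_mul]
        ring

end Identity

/-! ### A Chebyshev criterion. -/

section ConvergenceInMeasure

/-- Markov's inequality for the majorant `W`; since integrability is asked of `W` only, `Z` needs no
measurability. -/
lemma tendstoInMeasure_zero_of_sq_le {Ω : Type*} [MeasurableSpace Ω] {P : Measure Ω}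
    [IsProbabilityMeasure P] {Z W : ℕ → Ω → ℝ} (hW : ∀ n, Integrable (W n) P)
    (hZW : ∀ᶠ n in atTop, ∀ᵐ ω ∂P, Z n ω ^ 2 ≤ W n ω)
    (hW0 : ∀ n, ∀ ω, 0 ≤ W n ω)
    (hlim : Tendsto (fun n => ∫ ω, W n ω ∂P) atTop (𝓝 0)) :
    TendstoInMeasure P Z atTop 0 := by
  rw [tendstoInMeasure_iff_measureReal_norm]
  intro ε hε
  have hl : Tendsto (fun n => (∫ ω, W n ω ∂P) / ε ^ 2) atTop (𝓝 0) := by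
    simpa using hlim.div_const (ε ^ 2)
  refine squeeze_zero' (Eventually.of_forall fun n => measureReal_nonneg) ?_ hl
  filter_upwards [hZW] with n hn
  rw [le_div_iff₀ (by positivity), mul_comm]
  refine le_trans ?_ (mul_meas_ge_le_integral_of_nonneg (ae_of_all _ (hW0 n)) (hW n) (ε ^ 2))
  refine mul_le_mul_of_nonneg_left ?_ (sq_nonneg _)
  refine ENNReal.toReal_mono (measure_ne_top _ _) (measure_mono_ae ?_)
  filter_upwards [hn] with ω hω hε'
  have h1 : ε ≤ ‖Z n ω - (0 : Ω → ℝ) ω‖ := hε'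
  rw [Pi.zero_apply, sub_zero, Real.norm_eq_abs] at h1
  have h2 : ε ^ 2 ≤ Z n ω ^ 2 := by
    rw [← sq_abs (Z n ω)]; exact pow_le_pow_left₀ hε.le h1 2
  exact h2.trans hω

end ConvergenceInMeasure

/-! ### Distance from the statistic to its linear part. -/

section Remainder

variable {μ : Measure ℝ} [IsProbabilityMeasure μ]

/-- The integral statistic agrees with its linear part up to a degenerate sum and a deterministic
error. -/
lemma sq_integralStat_sub_linear_le {x : ℕ → ℝ} (hx : ∀ i, x i ∈ Set.Ioo (0 : ℝ) 1)
    (hinj : ∀ i j, i ≠ j → x i ≠ x j) {n : ℕ} (hn : 2 ≤ n) :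
    (√(n : ℝ) * integralStat x n
        - (√(n : ℝ))⁻¹ * ∑ i ∈ Finset.range n, 3 * projection kernelPR μ (x i)) ^ 2
      ≤ (2 * (∑ a ∈ distinctTriples n, residual μ (x a.1) (x a.2.1) (x a.2.2)) ^ 2
        + 648 * (n : ℝ) ^ 4) / ((n : ℝ) ^ 3 * (n - 1) ^ 2) := by
  have hn2 : (2 : ℝ) ≤ n := by exact_mod_cast hn
  have hn0 : (0 : ℝ) < n := by linarith
  have hn1 : (0 : ℝ) < n - 1 := by linarith
  have hmain := integralStat_eq_sum hx hinj hn
  have hsplit := sum_triple_split x (projection ratioInd μ)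
    (projection (fun s x y => ratioInd x y s) μ) ratioInd n
  have hD := abs_sum_sub_sum_distinctTriples_le
    (f := fun a => residual μ (x a.1) (x a.2.1) (x a.2.2)) (C := 5)
    (fun a => abs_residual_le _ _ _) n
  simp only [residual] at hD ⊢
  rw [hsplit] at hD
  have hlin : ∑ i ∈ Finset.range n, 3 * projection kernelPR μ (x i)
      = ∑ i ∈ Finset.range n, (2 * projection ratioInd μ (x i)
        + projection (fun s x y => ratioInd x y s) μ (x i)) - 3 / 2 * n := by
    have : ∀ i, 3 * projection kernelPR μ (x i) = (2 * projection ratioInd μ (x i)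
        + projection (fun s x y => ratioInd x y s) μ (x i)) - 3 / 2 := fun i => by
      rw [projection_kernelPR]; ring
    simp only [this, Finset.sum_sub_distrib, Finset.sum_const, Finset.card_range, nsmul_eq_mul]
    ring
  have hbound : |∑ i ∈ Finset.range n, 3 * projection kernelPR μ (x i)| ≤ 3 / 2 * n := by
    refine (Finset.abs_sum_le_sum_abs _ _).trans ?_
    refine (Finset.sum_le_card_nsmul _ _ (3 / 2) fun i _ => ?_).trans (le_of_eq ?_)
    · have := abs_projection_le (μ := μ) abs_kernelPR_le (x i)
      rw [abs_mul, abs_of_pos (by norm_num : (0 : ℝ) < 3)]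
      linarith
    · simp [mul_comm]
  set L := ∑ i ∈ Finset.range n, 3 * projection kernelPR μ (x i)
  set Q := ∑ i ∈ Finset.range n, (2 * projection ratioInd μ (x i)
    + projection (fun s x y => ratioInd x y s) μ (x i))
  set R := ∑ i ∈ Finset.range n, ∑ j ∈ Finset.range n, ∑ k ∈ Finset.range n,
    ratioInd (x i) (x j) (x k)
  set S := ∑ a ∈ distinctTriples n, (ratioInd (x a.1) (x a.2.1) (x a.2.2)
    - projection ratioInd μ (x a.1) - projection ratioInd μ (x a.2.1)
    - projection (fun s x y => ratioInd x y s) μ (x a.2.2) + 1)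
  set I := integralStat x n
  set E := (n : ℝ) ^ 2 * (n - 1) * I - n * (n - 1) * L with hE
  -- Repeated indices cost `3 * 5 * n ^ 2`, the term `n * L` costs `3/2 * n ^ 2` and the
  -- deterministic term `n ^ 2`: at most `18 * n ^ 2`.
  have hES : |E - S| ≤ 18 * (n : ℝ) ^ 2 := by
    have e : E - S = (R - n ^ 2 * Q + n ^ 3 - S) + n * L + n * (2 * n - 1) / 2 := by
      rw [hE, hmain, hlin]; ring
    have hnL : |n * L| ≤ 3 / 2 * (n : ℝ) ^ 2 := by
      rw [abs_mul, abs_of_pos hn0]; nlinarith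
    have hc : |(n : ℝ) * (2 * n - 1) / 2| ≤ (n : ℝ) ^ 2 := by
      rw [abs_of_nonneg (by nlinarith)]; nlinarith
    rw [e]
    refine (abs_add_le _ _).trans ((add_le_add_left (abs_add_le _ _) _).trans ?_)
    nlinarith [sq_nonneg (n : ℝ)]
  -- `E ^ 2 ≤ 2 * S ^ 2 + 2 * (E - S) ^ 2`, and `648 = 2 * 18 ^ 2`.
  have hE2 : E ^ 2 ≤ 2 * S ^ 2 + 648 * (n : ℝ) ^ 4 := by
    have h1 : (E - S) ^ 2 ≤ (18 * (n : ℝ) ^ 2) ^ 2 := sq_le_sq' (abs_le.1 hES).1 (abs_le.1 hES).2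
    nlinarith [sq_nonneg (E - 2 * S)]
  have hsq : √(n : ℝ) ^ 2 = n := Real.sq_sqrt hn0.le
  have hs0 : √(n : ℝ) ≠ 0 := (Real.sqrt_pos.2 hn0).ne'
  have hZ : (√(n : ℝ) * I - (√(n : ℝ))⁻¹ * L) ^ 2 = E ^ 2 / ((n : ℝ) ^ 3 * (n - 1) ^ 2) := by
    have h1 : √(n : ℝ) * I - (√(n : ℝ))⁻¹ * L = (√(n : ℝ))⁻¹ * (n * I - L) := by
      field_simp
      rw [hsq]
      ring
    rw [h1, mul_pow, inv_pow, hsq, hE]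
    field_simp
  rw [hZ]
  gcongr

end Remainder

/-! ### Central limit theorem and Slutsky's lemma. -/

section AsymptoticNormality

variable {Ω : Type*} [MeasurableSpace Ω] {P : Measure Ω}
  {X : ℕ → Ω → ℝ} {lam : ℝ} {μ : Measure ℝ} [IsProbabilityMeasure μ]

lemma ae_forall_mem_Ioo (hX : ∀ i, Measurable (X i)) (hμ : ∀ i, P.map (X i) = μ)
    (h : IsPowerLaw lam μ) : ∀ᵐ ω ∂P, ∀ i, X i ω ∈ Set.Ioo (0 : ℝ) 1 :=
  ae_all_iff.2 fun i => ae_of_ae_map (hX i).aemeasurable ((hμ i).symm ▸ h.ae_mem_Ioo)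

/-- The integral is against a random measure; almost surely it is a finite average, whose
measurability is clear. -/
lemma aemeasurable_integralStat (hX : ∀ i, Measurable (X i))
    (hmem : ∀ᵐ ω ∂P, ∀ i, X i ω ∈ Set.Ioo (0 : ℝ) 1) (n : ℕ) :
    AEMeasurable (fun ω => integralStat (fun i => X i ω) n) P := by
  refine ⟨fun ω => (n : ℝ)⁻¹ * ∑ k ∈ Finset.range n, (uEmpDF (fun i => X i ω) n (X k ω)
    - empDF (fun i => X i ω) n (X k ω)), ?_, ?_⟩
  · refine (Finset.measurable_sum _ fun k _ => Measurable.sub ?_ ?_).const_mul _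
    · refine (Finset.measurable_sum _ fun j _ => Finset.measurable_sum _ fun i _ => ?_).const_mul _
      exact Measurable.ite (measurableSet_lt (by fun_prop) (hX k)) measurable_const
        measurable_const
    · refine (Finset.measurable_sum _ fun i _ => ?_).const_mul _
      exact Measurable.ite (measurableSet_lt (hX i) (hX k)) measurable_const measurable_const
  · filter_upwards [hmem] with ω hω using integralStat_eq_average hω n

variable [IsProbabilityMeasure P]

lemma ae_forall_ne (hX : ∀ i, Measurable (X i)) (hindep : iIndepFun X P)
    (hμ : ∀ i, P.map (X i) = μ) (h : IsPowerLaw lam μ) :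
    ∀ᵐ ω ∂P, ∀ i j, i ≠ j → X i ω ≠ X j ω := by
  refine ae_all_iff.2 fun i => ae_all_iff.2 fun j => ?_
  by_cases hij : i = j
  · simp [hij]
  have hs : MeasurableSet {p : ℝ × ℝ | p.1 = p.2} :=
    measurableSet_eq_fun measurable_fst measurable_snd
  have h0 : (μ.prod μ) {p : ℝ × ℝ | p.1 = p.2} = 0 := by
    rw [Measure.measure_prod_null hs]
    refine ae_of_all _ fun x => ?_
    have : Prod.mk x ⁻¹' {p : ℝ × ℝ | p.1 = p.2} = {x} := by ext y; simp [eq_comm]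
    change μ (Prod.mk x ⁻¹' {p : ℝ × ℝ | p.1 = p.2}) = 0
    rw [this, h.measure_singleton]
  have h1 : ∀ᵐ p ∂(P.map fun ω => (X i ω, X j ω)), p.1 ≠ p.2 := by
    rw [map_pair_eq_prod hX hindep hμ hij, ae_iff]
    simpa using h0
  filter_upwards [ae_of_ae_map ((hX i).prodMk (hX j)).aemeasurable h1] with ω hω _
  exact hω

lemma tendstoInMeasure_integralStat_sub_linear (hX : ∀ i, Measurable (X i))
    (hindep : iIndepFun X P) (hμ : ∀ i, P.map (X i) = μ) (h : IsPowerLaw lam μ) :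
    TendstoInMeasure P (fun (n : ℕ) ω => √(n : ℝ) * integralStat (fun i => X i ω) n
      - (√(n : ℝ))⁻¹ * ∑ i ∈ Finset.range n, 3 * projection kernelPR μ (X i ω)) atTop 0 := by
  have hSm : ∀ n, Measurable fun ω =>
      ∑ a ∈ distinctTriples n, residual μ (X a.1 ω) (X a.2.1 ω) (X a.2.2 ω) := fun n =>
    Finset.measurable_sum _ fun a _ =>
      measurable_residual.comp (f := fun ω => (X a.1 ω, X a.2.1 ω, X a.2.2 ω)) (by fun_prop)
  have hSi : ∀ n, Integrable (fun ω =>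
      (∑ a ∈ distinctTriples n, residual μ (X a.1 ω) (X a.2.1 ω) (X a.2.2 ω)) ^ 2) P := by
    intro n
    refine Integrable.of_bound ((hSm n).pow_const 2).aestronglyMeasurable
      (((distinctTriples n).card * 5) ^ 2) (ae_of_all _ fun ω => ?_)
    rw [norm_pow]
    refine pow_le_pow_left₀ (norm_nonneg _) ?_ 2
    refine (norm_sum_le _ _).trans ((Finset.sum_le_card_nsmul _ _ 5 fun a _ => ?_).trans ?_)
    · exact abs_residual_le _ _ _
    · rw [nsmul_eq_mul]
  refine tendstoInMeasure_zero_of_sq_le (W := fun n ω =>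
    (2 * (∑ a ∈ distinctTriples n, residual μ (X a.1 ω) (X a.2.1 ω) (X a.2.2 ω)) ^ 2
        + 648 * (n : ℝ) ^ 4) / ((n : ℝ) ^ 3 * (n - 1) ^ 2)) ?_ ?_ ?_ ?_
  · exact fun n => (((hSi n).const_mul 2).add (integrable_const _)).div_const _
  · filter_upwards [eventually_ge_atTop 2] with n hn
    filter_upwards [ae_forall_mem_Ioo hX hμ h, ae_forall_ne hX hindep hμ h] with ω h1 h2
    exact sq_integralStat_sub_linear_le h1 h2 hn
  · intro n ω; positivity
  -- `7992 = 4 * (2 * 27 * 5 ^ 2 + 648)`, the factor `4` coming from `n ≤ 2 * (n - 1)`.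
  · have hlim : Tendsto (fun n : ℕ => 7992 / (n : ℝ)) atTop (𝓝 0) :=
      tendsto_const_div_atTop_nhds_zero_nat _
    refine squeeze_zero' (Eventually.of_forall fun n => integral_nonneg fun ω => ?_) ?_ hlim
    · simp only [Pi.zero_apply]; positivity
    filter_upwards [eventually_ge_atTop 2] with n hn
    have hn2 : (2 : ℝ) ≤ n := by exact_mod_cast hn
    have hn0 : (0 : ℝ) < n := by linarith
    have hn1 : (0 : ℝ) < n - 1 := by linarith
    have hm := integral_sq_sum_distinctTriples_le hX hindep hμ measurable_residual
      abs_residual_le h.projection_residual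
      (by simpa only [residual_comm] using h.projection_residual)
      h.projection_residual_last n
    rw [integral_div, integral_add ((hSi n).const_mul 2) (integrable_const _),
      integral_const_mul, div_le_div_iff₀ (by positivity) hn0]
    simp only [integral_const, probReal_univ, one_smul]
    have h4 : (n : ℝ) ^ 2 ≤ 4 * (n - 1) ^ 2 := by nlinarith
    calc _ ≤ (2 * (27 * 5 ^ 2 * (n : ℝ) ^ 4) + 648 * (n : ℝ) ^ 4) * n := by gcongr
      _ = 1998 * n ^ 3 * n ^ 2 := by ring
      _ ≤ 1998 * n ^ 3 * (4 * (n - 1) ^ 2) := by gcongr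
      _ = _ := by ring

lemma tendstoInDistribution_linear (hX : ∀ i, Measurable (X i))
    (hindep : iIndepFun X P) (hμ : ∀ i, P.map (X i) = μ) (h : IsPowerLaw lam μ) :
    TendstoInDistribution (fun (n : ℕ) ω => (√(n : ℝ))⁻¹ *
      ∑ i ∈ Finset.range n, 3 * projection kernelPR μ (X i ω)) atTop (id : ℝ → ℝ)
      (fun _ => P) (gaussianReal 0 (5 / 108)) := by
  have hm : Measurable fun s => 3 * projection kernelPR μ s :=
    (measurable_projection measurable_kernelPR).const_mul 3
  set Y : ℕ → Ω → ℝ := fun i ω => 3 * projection kernelPR μ (X i ω) with hY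
  have hYm : ∀ i, Measurable (Y i) := fun i => hm.comp (hX i)
  have hmean : ∫ ω, Y 0 ω ∂P = 0 := by
    rw [← integral_map (φ := X 0) (f := fun s => 3 * projection kernelPR μ s)
      (hX 0).aemeasurable hm.aestronglyMeasurable, hμ, integral_const_mul,
      h.integral_projection_kernelPR, mul_zero]
  -- `3 ^ 2 * (5 / 972) = 5 / 108`, the `3` being the degree of the kernel.
  have hvar : Var[Y 0; P] = 5 / 108 := by
    have e : Y 0 = (fun s => 3 * projection kernelPR μ s) ∘ X 0 := rfl
    rw [e, ← variance_map hm.aemeasurable (hX 0).aemeasurable, hμ, variance_const_mul,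
      h.variance_projection_kernelPR]
    norm_num
  have hv : Var[Y 0; P].toNNReal = 5 / 108 := by
    rw [hvar]
    ext
    rw [Real.coe_toNNReal _ (by norm_num)]
    norm_num
  have hclt := tendstoInDistribution_inv_sqrt_mul_sum_sub (P := P) (X := Y)
    (Y := (id : ℝ → ℝ)) (P' := gaussianReal 0 (5 / 108)) (by rw [hv]; exact HasLaw.id)
    (MemLp.of_bound (hYm 0).aestronglyMeasurable (3 / 2) (ae_of_all _ fun ω => by
      have := abs_projection_le (μ := μ) abs_kernelPR_le (X 0 ω)
      rw [hY, Real.norm_eq_abs, abs_mul, abs_of_pos (by norm_num : (0 : ℝ) < 3)]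
      linarith))
    (hindep.comp (fun _ s => 3 * projection kernelPR μ s) fun _ => hm)
    (fun i => (IdentDistrib.mk (hX i).aemeasurable (hX 0).aemeasurable
      ((hμ i).trans (hμ 0).symm)).comp hm)
  simpa only [hmean, mul_zero, sub_zero] using hclt

lemma tendstoInDistribution_integralStat (hX : ∀ i, Measurable (X i))
    (hindep : iIndepFun X P) (hμ : ∀ i, P.map (X i) = μ) (h : IsPowerLaw lam μ) :
    TendstoInDistribution (fun (n : ℕ) ω => √(n : ℝ) * integralStat (fun i => X i ω) n) atTop
      (id : ℝ → ℝ) (fun _ => P) (gaussianReal 0 (5 / 108)) :=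
  tendstoInDistribution_of_tendstoInMeasure_sub _ _ (tendstoInDistribution_linear hX hindep hμ h)
    (tendstoInMeasure_integralStat_sub_linear hX hindep hμ h) fun n =>
      (aemeasurable_integralStat hX (ae_forall_mem_Ioo hX hμ h) n).const_mul _

end AsymptoticNormality

end PuriRubin

theorem mainTheorem8 {Ω : Type*} [MeasurableSpace Ω] (P : Measure Ω) [IsProbabilityMeasure P]
    (X : ℕ → Ω → ℝ) (hX : ∀ i, Measurable (X i)) (hindep : iIndepFun X P)
    (lam : ℝ) (hlaw : ∀ i, PuriRubin.IsPowerLaw lam (P.map (X i))) :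
    -- the kernel is centred
    (∫ ω, PuriRubin.kernelPR (X 0 ω) (X 1 ω) (X 2 ω) ∂P = 0) ∧
    -- its projection, pointwise and as a conditional expectation
    (∀ s ∈ Set.Icc (0 : ℝ) 1,
      PuriRubin.projection PuriRubin.kernelPR (P.map (X 0)) s
        = 1 / 6 + 2 / 3 * s ^ lam * Real.log (s ^ lam)) ∧
    (P[fun ω => PuriRubin.kernelPR (X 0 ω) (X 1 ω) (X 2 ω) |
        MeasurableSpace.comap (X 0) inferInstance]
      =ᵐ[P] fun ω => 1 / 6 + 2 / 3 * (X 0 ω) ^ lam * Real.log ((X 0 ω) ^ lam)) ∧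
    -- the variance of the projection, and non-degeneracy
    Var[PuriRubin.projection PuriRubin.kernelPR (P.map (X 0)); P.map (X 0)] = 5 / 972 ∧
    PuriRubin.IsNonDegenerate PuriRubin.kernelPR (P.map (X 0)) ∧
    -- asymptotic normality of the integral statistic
    TendstoInDistribution
      (fun (n : ℕ) ω => √(n : ℝ) * PuriRubin.integralStat (fun i => X i ω) n) atTop
      (id : ℝ → ℝ) (fun _ => P) (gaussianReal 0 (5 / 108)) := by

  have : IsProbabilityMeasure (P.map (X 0)) :=
    Measure.isProbabilityMeasure_map (hX 0).aemeasurable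
  have hμ : ∀ i, P.map (X i) = P.map (X 0) := fun i => by
    have : IsProbabilityMeasure (P.map (X i)) :=
      Measure.isProbabilityMeasure_map (hX i).aemeasurable
    exact (hlaw i).unique (hlaw 0)
  have h := hlaw 0
  have hvar := h.variance_projection_kernelPR
  refine ⟨?_, fun s hs => h.projection_kernelPR hs, ?_, hvar, ?_,
    PuriRubin.tendstoInDistribution_integralStat hX hindep hμ h⟩
  · have e := PuriRubin.setIntegral_kernel_eq hX hindep hμ PuriRubin.measurable_kernelPR
      PuriRubin.abs_kernelPR_le MeasurableSet.univ
    simp only [Set.preimage_univ, Measure.restrict_univ] at e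
    rw [e, ← integral_map (φ := X 0) (hX 0).aemeasurable
      (PuriRubin.measurable_projection PuriRubin.measurable_kernelPR).aestronglyMeasurable,
      h.integral_projection_kernelPR]
  · refine (PuriRubin.condExp_kernel_ae_eq hX hindep hμ PuriRubin.measurable_kernelPR
      PuriRubin.abs_kernelPR_le).trans ?_
    filter_upwards [PuriRubin.ae_forall_mem_Ioo hX hμ h] with ω hω
    exact h.projection_kernelPR ⟨(hω 0).1.le, (hω 0).2.le⟩
  · rw [PuriRubin.IsNonDegenerate, hvar]
    norm_num
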